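/- Let $X$ be a complex Banach space and $L(X)$ the algebra of bounded linear operators on $X$; $R(\cdot)$ and $N(\cdot)$ denote range and null space. For a commuting tuple $T=(T_1,\ldots,T_n)\in L(X)^n$ define $\hat T\colon X^n\to X$, $\hat T(x_1,\ldots,x_n)=\sum_{i=1}^n T_ix_i$, and $\tilde T\colon X\to X^n$, $\tilde T(x)=(T_1x,\ldots,T_nx)$, and put $$R^\infty(T)=\bigcap_{k\ge 1}\bigl(R(T_1^k)+\cdots+R(T_n^k)\bigr),\qquad N^\infty(T)=\bigcup_{k\ge 1}\bigl(N(T_1^k)\cap\cdots\cap N(T_n^k)\bigr).$$ The tuple $T$ is called lower split semi-Browder if $R^\infty(T)$ has finite codimension in $X$ and $N(\hat T)$ has a topological direct complement in $X^n$ (i.e. it is the range of a bounded linear projection). It is called upper split semi-Browder if $N(\tilde T)$ is finite dimensional, $R(\tilde T)$ is closed, $N^\infty(T)$ is finite dimensional, and $R(\tilde T)$ has a topological direct complement in $X^n$. The lower (respectively upper) split semi-Browder spectrum $sp_{\mathcal B_-}(T)$ (respectively $sp_{\mathcal B_+}(T)$) is the set of all $\lambda=(\lambda_1,\ldots,\lambda_n)\in\mathbb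 C^n$ such that $T-\lambda=(T_1-\lambda_1I,\ldots,T_n-\lambda_nI)$ is not lower (respectively upper) split semi-Browder. **Proposition 3.2.** Let $X$ be a complex Banach space, let $n\ge 1$, let $T=(T_1,\ldots,T_n,T_{n+1})$ be a commuting tuple of bounded linear operators on $X$, and let $\pi\colon\mathbb C^{n+1}\to\mathbb C^n$ be the projection onto the first $n$ coordinates. Then (i) $\pi\bigl(sp_{\mathcal B_-}(T_1,\ldots,T_n,T_{n+1})\bigr)=sp_{\mathcal B_-}(T_1,\ldots,T_n)$; (ii) $\pi\bigl(sp_{\mathcal B_+}(T_1,\ldots,T_n,T_{n+1})\bigr)=sp_{\mathcal B_+}(T_1,\ldots,T_n)$. -/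

import Mathlib

namespace SemiBrowder

section
variable {X : Type*} [NormedAddCommGroup X] [NormedSpace ℂ X] {n : ℕ}

/-- The tuple `T - λ = (T₁ - λ₁ I, …, Tₙ - λₙ I)`. -/
def shift (T : Fin n → X →L[ℂ] X) (lam : Fin n → ℂ) : Fin n → X →L[ℂ] X :=
  fun i => T i - lam i • ContinuousLinearMap.id ℂ X

/-- The row operator `T̂ : Xⁿ → X`, `T̂ (x₁, …, xₙ) = T₁ x₁ + ⋯ + Tₙ xₙ`. -/
noncomputable def rowOp (T : Fin n → X →L[ℂ] X) : (Fin n → X) →L[ℂ] X :=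
  ∑ i, (T i).comp (ContinuousLinearMap.proj i)

/-- The column operator `T̃ : X → Xⁿ`, `T̃ x = (T₁ x, …, Tₙ x)`. -/
def colOp (T : Fin n → X →L[ℂ] X) : X →L[ℂ] (Fin n → X) :=
  ContinuousLinearMap.pi T

theorem rowOp_apply (T : Fin n → X →L[ℂ] X) (x : Fin n → X) :
    rowOp T x = ∑ i, T i (x i) := by
  simp [rowOp]

theorem colOp_apply (T : Fin n → X →L[ℂ] X) (x : X) (i : Fin n) :
    colOp T x i = T i x := rfl

/-- `M_k(T) = R(T₁ᵏ) + ⋯ + R(Tₙᵏ)`. -/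
def powRange (T : Fin n → X →L[ℂ] X) (k : ℕ) : Submodule ℂ X :=
  ⨆ i, (T i ^ k).range

/-- `R^∞(T)`, the intersection of the `M_k(T)` over all `k ≥ 1`. -/
def rangeInf (T : Fin n → X →L[ℂ] X) : Submodule ℂ X :=
  ⨅ k : ℕ, powRange T (k + 1)

/-- `N(T₁ᵏ) ∩ ⋯ ∩ N(Tₙᵏ)`. -/
def powKer (T : Fin n → X →L[ℂ] X) (k : ℕ) : Submodule ℂ X :=
  ⨅ i, (T i ^ k).ker

/-- `N^∞(T)`, the union over `k ≥ 1` of the increasing sequence of subspaces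
`N(T₁ᵏ) ∩ ⋯ ∩ N(Tₙᵏ)`; see `mem_kerInf`. -/
def kerInf (T : Fin n → X →L[ℂ] X) : Submodule ℂ X :=
  ⨆ k : ℕ, powKer T (k + 1)

theorem powKer_mono (T : Fin n → X →L[ℂ] X) : Monotone (powKer T) := by
  refine monotone_nat_of_le_succ fun k x hx => ?_
  simp only [powKer, Submodule.mem_iInf] at hx ⊢
  intro i
  have h : (T i ^ k) x = 0 := hx i
  change (T i ^ (k + 1)) x = 0
  rw [pow_succ', mul_apply_eq_comp, h, map_zero]

/-- `N^∞(T)` is the set-theoretic union of the joint kernels. -/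
theorem mem_kerInf (T : Fin n → X →L[ℂ] X) (x : X) :
    x ∈ kerInf T ↔ ∃ k : ℕ, 1 ≤ k ∧ ∀ i, (T i ^ k) x = 0 := by
  have hd : Directed (· ≤ ·) fun k : ℕ => powKer T (k + 1) :=
    Monotone.directed_le fun a b h => powKer_mono T (Nat.succ_le_succ h)
  rw [kerInf, Submodule.mem_iSup_of_directed _ hd]
  simp only [powKer, Submodule.mem_iInf]
  constructor
  · rintro ⟨k, hk⟩
    exact ⟨k + 1, by omega, hk⟩
  · rintro ⟨k, hk1, hk⟩
    obtain ⟨m, rfl⟩ := Nat.exists_eq_add_of_le' hk1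
    exact ⟨m, hk⟩

/-- `T` is lower semi-Browder: `R^∞(T)` has finite codimension in `X`. -/
def IsLowerSemiBrowder (T : Fin n → X →L[ℂ] X) : Prop :=
  FiniteDimensional ℂ (X ⧸ rangeInf T)

/-- `T` is upper semi-Fredholm: `T̃` has finite dimensional null space and closed range. -/
def IsUpperSemiFredholm (T : Fin n → X →L[ℂ] X) : Prop :=
  FiniteDimensional ℂ (colOp T).ker ∧ IsClosed (Set.range (colOp T))

/-- `T` is upper semi-Browder: it is upper semi-Fredholm and `N^∞(T)` is finite dimensional. -/
def IsUpperSemiBrowder (T : Fin n → X →L[ℂ] X) : Prop :=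
  IsUpperSemiFredholm T ∧ FiniteDimensional ℂ (kerInf T)

/-- `T` is lower split semi-Browder: it is lower semi-Browder and `N(T̂)` has a
(topological) direct complement in `Xⁿ`. -/
def IsLowerSplitSemiBrowder (T : Fin n → X →L[ℂ] X) : Prop :=
  IsLowerSemiBrowder T ∧ (rowOp T).ker.ClosedComplemented

/-- `T` is upper split semi-Browder: it is upper semi-Browder and `R(T̃)` has a
(topological) direct complement in `Xⁿ`. -/
def IsUpperSplitSemiBrowder (T : Fin n → X →L[ℂ] X) : Prop :=
  IsUpperSemiBrowder T ∧ (colOp T).range.ClosedComplemented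

/-- The lower split semi-Browder spectrum `sp_{B₋}(T)`. -/
def lowerSplitSpectrum (T : Fin n → X →L[ℂ] X) : Set (Fin n → ℂ) :=
  {lam | ¬ IsLowerSplitSemiBrowder (shift T lam)}

/-- The upper split semi-Browder spectrum `sp_{B₊}(T)`. -/
def upperSplitSpectrum (T : Fin n → X →L[ℂ] X) : Set (Fin n → ℂ) :=
  {lam | ¬ IsUpperSplitSemiBrowder (shift T lam)}

end

end SemiBrowder

/-! Fix a commuting tuple `T` and a further operator `S` commuting with it. Both claims reduce to
this: `T` has the property iff `(T, S - μ)` has it for every `μ`. Passing from `T` to the longer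
tuple is easy; the converse splits into two independent parts.

Splitting: given the finiteness of `R^∞` or `N^∞`, the remaining conditions say exactly that the row
(column) operator has a right (left) inverse modulo finite rank, i.e. that `1` lies in the right
(left) ideal `J` generated by the entries and the finite rank operators. Multiplication by `S`
preserves `J`, and the hypothesis makes every `S - μ` onto modulo the closure of `J`. On a nonzero
Banach space some `R - μ` is not onto (take `μ` on the boundary of the spectrum), so `J` is dense.
It then contains a unit, hence `1`.

Finiteness: `S` acts on the joint generalized kernel of `T`, and its eigenvalues there already occur
on the finite dimensional joint kernel, so they are finitely many. Each generalized eigenspace lies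
in `N^∞(T, S - μ)`, which bounds the whole. For `R^∞` the same argument runs in the algebraic dual.
-/

namespace SemiBrowder

/-! ### Surjectivity of all translates, and ideals in Banach algebras -/

section Surjectivity

open ContinuousLinearMap

/-- If `μ - R` is onto and `μ` is a limit of points of the resolvent set, then `μ` is in the
resolvent set. -/
theorem isUnit_sub_algebraMap_of_mem_closure {E : Type*} [NormedAddCommGroup E]
    [NormedSpace ℂ E] [CompleteSpace E] (R : E →L[ℂ] E) {μ : ℂ}
    (hsurj : Function.Surjective (algebraMap ℂ (E →L[ℂ] E) μ - R))
    (hμ : μ ∈ closure (resolventSet ℂ R)) : μ ∈ resolventSet ℂ R := by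
  -- The open mapping theorem gives preimages of norm at most `C‖y‖`. For `ν` within `1 / (2C)` of
  -- `μ` the resolvent at `ν` then has norm at most `2C`, so a Neumann series around `ν` reaches
  -- `μ`.
  obtain ⟨C, hC0, hC⟩ := exists_preimage_norm_le _ hsurj
  obtain ⟨ν, hν, hd⟩ := Metric.mem_closure_iff.1 hμ (1 / (2 * C)) (by positivity)
  obtain ⟨u, hu⟩ : IsUnit (algebraMap ℂ (E →L[ℂ] E) ν - R) := hν
  set V : E →L[ℂ] E := ↑u⁻¹ with hV
  have hVu : ∀ x, V (ν • x - R x) = x := fun x => by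
    have := congrArg (fun f : E →L[ℂ] E => f x) u.inv_mul
    simpa [hu, Algebra.algebraMap_eq_smul_one] using this
  rw [dist_eq_norm] at hd
  have hV2 : ‖V‖ ≤ 2 * C := by
    have h1 : ‖V‖ ≤ C + ‖V‖ * (1 / 2) := by
      refine opNorm_le_bound _ (by positivity) fun y => ?_
      obtain ⟨x, rfl, hx⟩ := hC y
      set y := (algebraMap ℂ (E →L[ℂ] E) μ - R) x with hy
      have hyx : y = (ν • x - R x) + (μ - ν) • x := by
        simp [hy, Algebra.algebraMap_eq_smul_one, sub_smul]
      have hVy : V y = x + V ((μ - ν) • x) := by rw [hyx, map_add, hVu]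
      calc ‖V y‖ ≤ ‖x‖ + ‖V‖ * (‖μ - ν‖ * ‖x‖) := by
            rw [hVy]
            refine (norm_add_le _ _).trans (add_le_add le_rfl ((le_opNorm _ _).trans ?_))
            rw [norm_smul]
        _ ≤ C * ‖y‖ + ‖V‖ * (1 / (2 * C) * (C * ‖y‖)) := by gcongr
        _ = (C + ‖V‖ * (1 / 2)) * ‖y‖ := by field_simp
    linarith
  rcases subsingleton_or_nontrivial E with hE | hE
  · exact isUnit_of_subsingleton _
  have hVpos : 0 < ‖V‖ := Units.norm_pos u⁻¹
  have hnear : ‖(algebraMap ℂ (E →L[ℂ] E) μ - R) - u‖ < ‖V‖⁻¹ := by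
    have : (algebraMap ℂ (E →L[ℂ] E) μ - R) - u = algebraMap ℂ (E →L[ℂ] E) (μ - ν) := by
      rw [hu, map_sub]; abel
    rw [this, norm_algebraMap']
    refine hd.trans_le ?_
    rw [one_div]
    exact inv_anti₀ hVpos hV2
  exact ⟨u.ofNearby _ hnear, rfl⟩

/-- If every `R - μ` is onto then the Banach space is trivial. -/
theorem subsingleton_of_forall_surjective {E : Type*} [NormedAddCommGroup E]
    [NormedSpace ℂ E] [CompleteSpace E] (R : E →L[ℂ] E)
    (hsurj : ∀ μ : ℂ, Function.Surjective fun x => R x - μ • x) : Subsingleton E := by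
  by_contra hE
  rw [not_subsingleton_iff_nontrivial] at hE
  have hs : ∀ μ : ℂ, Function.Surjective (algebraMap ℂ (E →L[ℂ] E) μ - R) := fun μ y => by
    obtain ⟨x, hx⟩ := hsurj μ (-y)
    refine ⟨x, ?_⟩
    have hx' : R x - μ • x = -y := hx
    change μ • x - R x = y
    rw [← neg_sub, hx', neg_neg]
  -- In the connected plane a nonempty clopen resolvent set is everything, against the nonemptiness
  -- of the spectrum.
  have hcl : IsClopen (resolventSet ℂ R) :=
    ⟨isClosed_of_closure_subset fun μ hμ => isUnit_sub_algebraMap_of_mem_closure R (hs μ) hμ,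
      spectrum.isOpen_resolventSet R⟩
  have hne : (resolventSet ℂ R).Nonempty :=
    ⟨(‖R‖ + 1 : ℝ), spectrum.mem_resolventSet_of_norm_lt (by
      rw [Complex.norm_real, Real.norm_of_nonneg (by positivity)]; linarith)⟩
  obtain ⟨μ, hμ⟩ := spectrum.nonempty R
  exact hμ (by rw [hcl.eq_univ hne]; trivial)

/-- A closed subspace invariant under `R` modulo which all the operators `R - μ` are onto is the
whole space. -/
theorem eq_top_of_forall_surjective_mod {E : Type*} [NormedAddCommGroup E]
    [NormedSpace ℂ E] [CompleteSpace E] (R : E →L[ℂ] E) (M : Submodule ℂ E)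
    (hM : IsClosed (M : Set E)) (hR : ∀ x ∈ M, R x ∈ M)
    (hsurj : ∀ (μ : ℂ) (y : E), ∃ x, R x - μ • x - y ∈ M) : M = ⊤ := by
  have : IsClosed (M : Set E) := hM
  let Q : (E ⧸ M) →L[ℂ] (E ⧸ M) := M.liftQL (M.mkQL ∘L R) fun x hx => by
    simpa using hR x hx
  rw [← Submodule.Quotient.subsingleton_iff]
  refine subsingleton_of_forall_surjective Q fun μ y => ?_
  obtain ⟨y, rfl⟩ := Submodule.Quotient.mk_surjective _ y
  obtain ⟨x, hx⟩ := hsurj μ y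
  refine ⟨Submodule.Quotient.mk x, ?_⟩
  rw [← Submodule.Quotient.mk_eq_zero, Submodule.Quotient.mk_sub, Submodule.Quotient.mk_sub,
    Submodule.Quotient.mk_smul, sub_eq_zero] at hx
  rw [← hx]
  simp [Q]

/-- A dense subspace of a Banach algebra contains a unit. -/
theorem exists_isUnit_mem_of_closure_eq_top {A : Type*} [NormedRing A] [NormedAlgebra ℂ A]
    [CompleteSpace A] (J : Submodule ℂ A) (h : J.topologicalClosure = ⊤) :
    ∃ u : Aˣ, (u : A) ∈ J := by
  have h1 : (1 : A) ∈ closure (J : Set A) := by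
    rw [← Submodule.topologicalClosure_coe, h]; trivial
  obtain ⟨_, ⟨u, rfl⟩, hu⟩ := mem_closure_iff.1 h1 {x | IsUnit x} Units.isOpen isUnit_one
  exact ⟨u, hu⟩

/-- Modulo the closure of `J`, left multiplication by `s - μ` is onto, since `b * y` is a preimage
of `y`. Hence `J` is dense. -/
theorem one_mem_of_right_ideal {A : Type*} [NormedRing A] [NormedAlgebra ℂ A]
    [CompleteSpace A] (J : Submodule ℂ A) (hJ : ∀ a ∈ J, ∀ b, a * b ∈ J) (s : A)
    (hs : ∀ a ∈ J, s * a ∈ J)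
    (h : ∀ μ : ℂ, ∃ b, (s - algebraMap ℂ A μ) * b - 1 ∈ J) : (1 : A) ∈ J := by
  have htop : J.topologicalClosure = ⊤ := by
    refine eq_top_of_forall_surjective_mod (ContinuousLinearMap.mul ℂ A s) _
      J.isClosed_topologicalClosure (fun x hx => ?_) fun μ y => ?_
    · exact map_mem_closure (ContinuousLinearMap.mul ℂ A s).continuous hx hs
    · obtain ⟨b, hb⟩ := h μ
      refine ⟨b * y, J.le_topologicalClosure ?_⟩
      have := hJ _ hb y
      rwa [sub_mul, one_mul, mul_assoc, sub_mul, ← Algebra.smul_def] at this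
  obtain ⟨u, hu⟩ := exists_isUnit_mem_of_closure_eq_top J htop
  simpa using hJ _ hu ↑u⁻¹

theorem one_mem_of_left_ideal {A : Type*} [NormedRing A] [NormedAlgebra ℂ A]
    [CompleteSpace A] (J : Submodule ℂ A) (hJ : ∀ a ∈ J, ∀ b, b * a ∈ J) (s : A)
    (hs : ∀ a ∈ J, a * s ∈ J)
    (h : ∀ μ : ℂ, ∃ b, b * (s - algebraMap ℂ A μ) - 1 ∈ J) : (1 : A) ∈ J := by
  have htop : J.topologicalClosure = ⊤ := by
    refine eq_top_of_forall_surjective_mod ((ContinuousLinearMap.mul ℂ A).flip s) _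
      J.isClosed_topologicalClosure (fun x hx => ?_) fun μ y => ?_
    · exact map_mem_closure ((ContinuousLinearMap.mul ℂ A).flip s).continuous hx hs
    · obtain ⟨b, hb⟩ := h μ
      refine ⟨y * b, J.le_topologicalClosure ?_⟩
      have := hJ _ hb y
      rwa [mul_sub, mul_one, ← mul_assoc, mul_sub, ← Algebra.commutes, ← Algebra.smul_def] at this
  obtain ⟨u, hu⟩ := exists_isUnit_mem_of_closure_eq_top J htop
  simpa using hJ _ hu ↑u⁻¹

end Surjectivity

/-! ### Joint generalized kernels of commuting endomorphisms -/

section Joint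
variable {ι V : Type*} [AddCommGroup V] [Module ℂ V]

/-- The subspace of vectors annihilated by all products of `k` factors from `T`. -/
def jointKer (T : ι → Module.End ℂ V) : ℕ → Submodule ℂ V
  | 0 => ⊥
  | k + 1 => ⨅ i, (jointKer T k).comap (T i)

theorem mem_jointKer_succ (T : ι → Module.End ℂ V) (k : ℕ) (x : V) :
    x ∈ jointKer T (k + 1) ↔ ∀ i, T i x ∈ jointKer T k := by
  simp [jointKer]

theorem mem_jointKer_one (T : ι → Module.End ℂ V) (x : V) :
    x ∈ jointKer T 1 ↔ ∀ i, T i x = 0 := by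
  simp [jointKer]

theorem pow_apply_eq_zero_of_mem_jointKer (T : ι → Module.End ℂ V) :
    ∀ (k : ℕ) (x : V), x ∈ jointKer T k → ∀ i, (T i ^ k) x = 0
  | 0, x, hx, i => by simpa [jointKer] using hx
  | k + 1, x, hx, i => by
    rw [pow_succ]
    exact pow_apply_eq_zero_of_mem_jointKer T k _ ((mem_jointKer_succ T k x).1 hx i) i

/-- Applying `T i` lowers the exponent needed at `i` by one, so the sum of the exponents drops. The
extra `1` is needed only for the empty tuple. -/
theorem mem_jointKer_of_pow_apply_eq_zero [Fintype ι] (T : ι → Module.End ℂ V)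
    (hT : ∀ i j, Commute (T i) (T j)) :
    ∀ (m : ℕ) (α : ι → ℕ), ∑ i, α i = m → ∀ x, (∀ i, (T i ^ α i) x = 0) →
      x ∈ jointKer T (m + 1) := by
  classical
  intro m
  induction m with
  | zero =>
    intro α hα x hx
    rw [mem_jointKer_one]
    intro i
    have hi : α i = 0 := by
      simpa using (Finset.sum_eq_zero_iff.1 hα) i (Finset.mem_univ i)
    have : x = 0 := by simpa [hi] using hx i
    simp [this]
  | succ m ih =>
    intro α hα x hx
    rw [mem_jointKer_succ]
    intro i
    by_cases hi : α i = 0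
    · have : x = 0 := by simpa [hi] using hx i
      simp [this]
    refine ih (Function.update α i (α i - 1)) ?_ _ fun j => ?_
    · have := Finset.sum_update_of_mem (Finset.mem_univ i) α (α i - 1)
      have h2 := Finset.add_sum_erase Finset.univ α (Finset.mem_univ i)
      rw [Finset.sdiff_singleton_eq_erase] at this
      omega
    · by_cases hj : j = i
      · subst hj
        have := hx j
        rw [← Nat.sub_add_cancel (Nat.one_le_iff_ne_zero.2 hi), pow_succ] at this
        simpa using this
      · rw [Function.update_of_ne hj]
        have hc : Commute (T j ^ α j) (T i) := (hT j i).pow_left _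
        rw [← Module.End.mul_apply, hc.eq, Module.End.mul_apply, hx j, map_zero]

/-- The map `x ↦ (T i x)` sends each level into a finite power of the previous one, with kernel in
the first level. -/
theorem finiteDimensional_jointKer [Finite ι] (T : ι → Module.End ℂ V)
    (h : FiniteDimensional ℂ (jointKer T 1)) (k : ℕ) : FiniteDimensional ℂ (jointKer T k) := by
  induction k with
  | zero => exact inferInstanceAs (FiniteDimensional ℂ (⊥ : Submodule ℂ V))
  | succ k ih =>
    rw [← Submodule.fg_iff_finiteDimensional] at *
    refine Submodule.fg_of_fg_map_of_fg_inf_ker (LinearMap.pi T) ?_ ?_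
    · have h1 : (jointKer T (k + 1)).map (LinearMap.pi T) ≤
          Submodule.pi Set.univ fun _ : ι => jointKer T k := by
        rintro _ ⟨x, hx, rfl⟩ i -
        exact (mem_jointKer_succ T k x).1 hx i
      have : FiniteDimensional ℂ (Submodule.pi Set.univ fun _ : ι => jointKer T k) :=
        Module.Finite.iff_fg.2 (Submodule.fg_pi fun _ => ih)
      exact Module.Finite.iff_fg.1 (Submodule.finiteDimensional_of_le h1)
    · have h1 : jointKer T (k + 1) ⊓ (LinearMap.pi T).ker ≤ jointKer T 1 := by
        rintro x ⟨-, hx⟩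
        rw [mem_jointKer_one]
        exact fun i => congrFun hx i
      have : FiniteDimensional ℂ (jointKer T 1) := Module.Finite.iff_fg.2 h
      exact Module.Finite.iff_fg.1 (Submodule.finiteDimensional_of_le h1)

theorem jointKer_invariant (T : ι → Module.End ℂ V) (S : Module.End ℂ V)
    (hS : ∀ i, Commute (T i) S) : ∀ (k : ℕ) (x : V), x ∈ jointKer T k → S x ∈ jointKer T k
  | 0, x, hx => by
    have : x = 0 := by simpa [jointKer] using hx
    simp [this]
  | k + 1, x, hx => by
    rw [mem_jointKer_succ] at hx ⊢
    intro i
    rw [← Module.End.mul_apply, (hS i).eq, Module.End.mul_apply]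
    exact jointKer_invariant T S hS k _ (hx i)

/-- If some `T i x` is nonzero, it is an eigenvector for the same `μ` one level lower. -/
theorem exists_eigenvector_mem_jointKer_one (T : ι → Module.End ℂ V) (S : Module.End ℂ V)
    (hS : ∀ i, Commute (T i) S) (μ : ℂ) : ∀ (k : ℕ) (x : V), x ∈ jointKer T k → x ≠ 0 →
      S x = μ • x → ∃ y ∈ jointKer T 1, y ≠ 0 ∧ S y = μ • y
  | 0, x, hx, h0, _ => absurd (by simpa [jointKer] using hx) h0
  | k + 1, x, hx, h0, he => by
    by_cases h : ∀ i, T i x = 0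
    · exact ⟨x, (mem_jointKer_one T x).2 h, h0, he⟩
    · push Not at h
      obtain ⟨i, hi⟩ := h
      refine exists_eigenvector_mem_jointKer_one T S hS μ k (T i x)
        ((mem_jointKer_succ T k x).1 hx i) hi ?_
      rw [← Module.End.mul_apply, ← (hS i).eq, Module.End.mul_apply, he, map_smul]

/-- If the joint kernel of `T` is finite dimensional and, for every `μ`, the joint generalized
kernel of `(T, S - μ)` lies in a finite dimensional subspace, then so does that of `T`. -/
theorem exists_finiteDimensional_of_forall_shift [Fintype ι] (T : ι → Module.End ℂ V)
    (hT : ∀ i j, Commute (T i) (T j)) (S : Module.End ℂ V) (hS : ∀ i, Commute (T i) S)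
    (h1 : FiniteDimensional ℂ (jointKer T 1)) (W : ℂ → Submodule ℂ V)
    (hWfin : ∀ μ, FiniteDimensional ℂ (W μ))
    (hW : ∀ (μ : ℂ) (x : V) (k : ℕ), (∀ i, (T i ^ k) x = 0) →
      ((S - algebraMap ℂ (Module.End ℂ V) μ) ^ k) x = 0 → x ∈ W μ) :
    ∃ W' : Submodule ℂ V, FiniteDimensional ℂ W' ∧
      ∀ (k : ℕ) (x : V), (∀ i, (T i ^ k) x = 0) → x ∈ W' := by
  let S₁ : Module.End ℂ (jointKer T 1) := S.restrict (jointKer_invariant T S hS 1)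
  let Λ : Set ℂ := {μ | S₁.HasEigenvalue μ}
  have hΛ : Λ.Finite := Module.End.finite_hasEigenvalue S₁
  have : Finite Λ := hΛ
  refine ⟨⨆ μ : Λ, W μ, inferInstance, fun k x hx => ?_⟩
  obtain ⟨m, hm⟩ : ∃ m, x ∈ jointKer T m :=
    ⟨_, mem_jointKer_of_pow_apply_eq_zero T hT _ (fun _ => k) rfl x hx⟩
  have := finiteDimensional_jointKer T h1 m
  let f : Module.End ℂ (jointKer T m) := S.restrict (jointKer_invariant T S hS m)
  have hf : ∀ (μ : ℂ) (j : ℕ) (y : jointKer T m),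
      (((f - algebraMap ℂ _ μ) ^ j) y : V) =
        ((S - algebraMap ℂ (Module.End ℂ V) μ) ^ j) (y : V) := by
    intro μ j
    induction j with
    | zero => intro y; rfl
    | succ j ih =>
      intro y
      rw [pow_succ, pow_succ, Module.End.mul_apply, Module.End.mul_apply, ih]
      rfl
  have hle : ⨆ μ, f.maxGenEigenspace μ ≤ (⨆ μ : Λ, W μ).comap (jointKer T m).subtype := by
    refine iSup_le fun μ => ?_
    by_cases hμ : μ ∈ Λ
    · refine le_trans (fun y hy => ?_)
        (Submodule.comap_mono (le_iSup (fun μ : Λ => W μ) ⟨μ, hμ⟩))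
      obtain ⟨j, hj⟩ := (Module.End.mem_maxGenEigenspace _ _ _).1 hy
      rw [← Algebra.algebraMap_eq_smul_one] at hj
      -- A common exponent is needed: `m` kills `y` under each `T i`, and `j` under `S - μ`.
      refine hW μ y (m + j) (fun i => ?_) ?_
      · rw [add_comm, pow_add, Module.End.mul_apply,
          pow_apply_eq_zero_of_mem_jointKer T m y y.2 i, map_zero]
      · rw [pow_add, Module.End.mul_apply, ← hf, hj]
        simp
    · have hbot : f.maxGenEigenspace μ = ⊥ := by
        by_contra hne
        have hev : f.HasEigenvalue μ := by
          by_contra hnot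
          exact hnot (Module.End.HasUnifEigenvalue.lt (k := ⊤) one_pos hne)
        obtain ⟨y, hy⟩ := hev.exists_hasEigenvector
        obtain ⟨z, hz, hz0, hSz⟩ := exists_eigenvector_mem_jointKer_one T S hS μ m y y.2
          (by simpa using hy.2) (congrArg Subtype.val hy.apply_eq_smul)
        exact hμ (Module.End.hasEigenvalue_of_hasEigenvector (x := ⟨z, hz⟩)
          ⟨Module.End.mem_eigenspace_iff.2 (Subtype.ext hSz), by simpa using hz0⟩)
      simp [hbot]
  rw [Module.End.iSup_maxGenEigenspace_eq_top] at hle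
  exact hle (Submodule.mem_top (x := (⟨x, hm⟩ : jointKer T m)))

end Joint


/-! ### One-sided inverses modulo finite rank and complemented subspaces -/

section Split

variable {X Y : Type*} [NormedAddCommGroup X] [NormedSpace ℂ X] [NormedAddCommGroup Y]
  [NormedSpace ℂ Y]

/-- The operators of finite rank, as a subspace of the bounded operators. -/
def finiteRank (X Y : Type*) [NormedAddCommGroup X] [NormedSpace ℂ X] [NormedAddCommGroup Y]
    [NormedSpace ℂ Y] : Submodule ℂ (X →L[ℂ] Y) :=
  (LinearMap.finiteRange ℂ X Y).comap (ContinuousLinearMap.coeLM ℂ)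

theorem mem_finiteRank {A : X →L[ℂ] Y} : A ∈ finiteRank X Y ↔ FiniteDimensional ℂ A.range := by
  rw [← Submodule.fg_iff_finiteDimensional]
  exact LinearMap.mem_finiteRange_iff_hasFiniteRange

theorem mul_mem_finiteRank_left {A : X →L[ℂ] X} (hA : A ∈ finiteRank X X) (B : X →L[ℂ] X) :
    B * A ∈ finiteRank X X :=
  LinearMap.HasNoetherianRange.comp_left (u := (A : X →ₗ[ℂ] X)) hA (B : X →ₗ[ℂ] X)

theorem mul_mem_finiteRank_right {A : X →L[ℂ] X} (hA : A ∈ finiteRank X X) (B : X →L[ℂ] X) :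
    A * B ∈ finiteRank X X :=
  LinearMap.HasNoetherianRange.comp_right (v := (A : X →ₗ[ℂ] X)) hA (B : X →ₗ[ℂ] X)

theorem range_comp_subtypeL_of_isCompl_ker (A : Y →L[ℂ] X) {Z : Submodule ℂ Y}
    (hc : IsCompl A.ker Z) : (A ∘L Z.subtypeL).range = A.range := by
  apply le_antisymm
  · rintro _ ⟨z, rfl⟩
    exact ⟨z, rfl⟩
  · rintro _ ⟨y, rfl⟩
    obtain ⟨k, hk, z, hz, rfl⟩ := Submodule.mem_sup.1
      (hc.sup_eq_top.symm ▸ Submodule.mem_top : y ∈ A.ker ⊔ Z)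
    refine ⟨⟨z, hz⟩, ?_⟩
    have : A k = 0 := hk
    simp [this]

theorem ker_comp_subtypeL_of_isCompl_ker (A : Y →L[ℂ] X) {Z : Submodule ℂ Y}
    (hc : IsCompl A.ker Z) : (A ∘L Z.subtypeL).ker = ⊥ := by
  rw [eq_bot_iff]
  intro z hz
  have : (z : Y) ∈ A.ker ⊓ Z := ⟨hz, z.2⟩
  rw [hc.inf_eq_bot] at this
  simpa using this

/-- With `Z` complementing the kernel and `G` the range, `Z × G → X` is an isomorphism. The `Z`
component of its inverse serves as `S`, with error in `G`. -/
theorem exists_right_inverse_mod_finiteRank [CompleteSpace X] [CompleteSpace Y]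
    (A : Y →L[ℂ] X)
    (hR : FiniteDimensional ℂ (X ⧸ A.range)) (hK : A.ker.ClosedComplemented) :
    ∃ S : X →L[ℂ] Y, A ∘L S - ContinuousLinearMap.id ℂ X ∈ finiteRank X X := by
  obtain ⟨Z, hZ, hc⟩ := hK.exists_isClosed_isCompl
  obtain ⟨G, hG⟩ := A.range.exists_isCompl
  have : FiniteDimensional ℂ G := (Submodule.quotientEquivOfIsCompl _ G hG).finiteDimensional
  have : CompleteSpace Z := hZ.completeSpace_coe
  have : CompleteSpace G := FiniteDimensional.complete ℂ G
  let f : Z →L[ℂ] X := A ∘L Z.subtypeL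
  have hrange : f.range = A.range := range_comp_subtypeL_of_isCompl_ker A hc
  have hker : f.ker = ⊥ := ker_comp_subtypeL_of_isCompl_ker A hc
  rw [← hrange] at hG
  let e := f.coprodSubtypeLEquivOfIsCompl hG hker
  have he : ∀ p, e p = A p.1 + p.2 := fun p => rfl
  refine ⟨Z.subtypeL ∘L ContinuousLinearMap.fst ℂ Z G ∘L e.symm.toContinuousLinearMap, ?_⟩
  rw [mem_finiteRank]
  refine Submodule.finiteDimensional_of_le (S₂ := G) ?_
  rintro _ ⟨x, rfl⟩
  have h := he (e.symm x)
  rw [e.apply_symm_apply] at h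
  have : A (e.symm x).1 - x = -(e.symm x).2 := by
    nth_rewrite 2 [h]
    abel
  change A (e.symm x).1 - x ∈ G
  rw [this]
  exact G.neg_mem (e.symm x).2.2

theorem finiteDimensional_quotient_range_of_comp_sub_id {A : Y →L[ℂ] X} {S : X →L[ℂ] Y}
    (h : A ∘L S - ContinuousLinearMap.id ℂ X ∈ finiteRank X X) :
    FiniteDimensional ℂ (X ⧸ A.range) := by
  rw [mem_finiteRank] at h
  let g := A.range.mkQ ∘ₗ (A ∘L S - ContinuousLinearMap.id ℂ X).range.subtype
  refine Module.Finite.of_surjective g fun q => ?_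
  obtain ⟨x, rfl⟩ := Submodule.Quotient.mk_surjective _ q
  refine ⟨⟨_, -x, rfl⟩, ?_⟩
  change Submodule.Quotient.mk (A (S (-x)) - -x) = _
  rw [Submodule.Quotient.eq]
  exact ⟨S (-x), by simp⟩

theorem closedComplemented_ker_of_comp_sub_id {A : Y →L[ℂ] X} {S : X →L[ℂ] Y}
    (h : A ∘L S - ContinuousLinearMap.id ℂ X ∈ finiteRank X X) : A.ker.ClosedComplemented := by
  rw [mem_finiteRank] at h
  set F := A ∘L S - ContinuousLinearMap.id ℂ X with hF
  have hFx : ∀ x, F x = A (S x) - x := fun x => rfl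
  obtain ⟨g₀, hg₀⟩ := (A : Y →ₗ[ℂ] X).rangeRestrict.exists_rightInverse_of_surjective
    (A : Y →ₗ[ℂ] X).range_rangeRestrict
  obtain ⟨g, hg⟩ := LinearMap.exists_extend g₀
  have hAg : ∀ y, A (g (A y)) = A y := fun y => by
    have h1 : g (A y) = g₀ ⟨A y, y, rfl⟩ := DFunLike.congr_fun hg ⟨A y, y, rfl⟩
    have h2 := DFunLike.congr_fun hg₀ ⟨A y, y, rfl⟩
    rw [h1]
    exact congrArg Subtype.val h2
  let g' : F.range →L[ℂ] Y := (g ∘ₗ F.range.subtype).toContinuousLinearMap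
  let F' : X →L[ℂ] F.range := F.codRestrict F.range fun x => ⟨x, rfl⟩
  -- `1 - S A` maps into the kernel up to the error `F A`, whose values lie in the range of `A`.
  -- Lifting them by the section `g` corrects this; `g` is merely linear, but is continuous on the
  -- finite dimensional range of `F`.
  let Q : Y →L[ℂ] Y := ContinuousLinearMap.id ℂ Y - S ∘L A + g' ∘L F' ∘L A
  have hQx : ∀ y, Q y = y - S (A y) + g (F (A y)) := fun y => rfl
  have hQ : ∀ y, Q y ∈ A.ker := fun y => by
    have h1 : F (A y) = A (S (A y) - y) := by rw [hFx, map_sub]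
    change A (Q y) = 0
    rw [hQx, h1, map_add, hAg, map_sub, map_sub]
    abel
  refine ⟨Q.codRestrict A.ker hQ, fun y => Subtype.ext ?_⟩
  have hy : A y = 0 := y.2
  change Q y = y
  rw [hQx, hy]
  simp

theorem exists_left_inverse_mod_finiteRank [CompleteSpace X] [CompleteSpace Y]
    (A : X →L[ℂ] Y) (hK : FiniteDimensional ℂ A.ker)
    (hR : A.range.ClosedComplemented) :
    ∃ L : Y →L[ℂ] X, L ∘L A - ContinuousLinearMap.id ℂ X ∈ finiteRank X X := by
  obtain ⟨Z, hZ, hc⟩ :=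
    (Submodule.ClosedComplemented.of_finiteDimensional A.ker).exists_isClosed_isCompl
  obtain ⟨G, hGc, hG⟩ := hR.exists_isClosed_isCompl
  have : CompleteSpace Z := hZ.completeSpace_coe
  have : CompleteSpace G := hGc.completeSpace_coe
  let f : Z →L[ℂ] Y := A ∘L Z.subtypeL
  have hrange : f.range = A.range := range_comp_subtypeL_of_isCompl_ker A hc
  have hker : f.ker = ⊥ := ker_comp_subtypeL_of_isCompl_ker A hc
  rw [← hrange] at hG
  let e := f.coprodSubtypeLEquivOfIsCompl hG hker
  have he : ∀ p, e p = A p.1 + p.2 := fun p => rfl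
  refine ⟨Z.subtypeL ∘L ContinuousLinearMap.fst ℂ Z G ∘L e.symm.toContinuousLinearMap, ?_⟩
  rw [mem_finiteRank]
  refine Submodule.finiteDimensional_of_le (S₂ := A.ker) ?_
  rintro _ ⟨x, rfl⟩
  obtain ⟨k, hk, z, hz, rfl⟩ := Submodule.mem_sup.1
    (hc.sup_eq_top.symm ▸ Submodule.mem_top : x ∈ A.ker ⊔ Z)
  have hk' : A k = 0 := hk
  have h : e.symm (A (k + z)) = (⟨z, hz⟩, 0) := by
    rw [e.symm_apply_eq, he]
    simp [hk']
  change ((e.symm (A (k + z))).1 : X) - (k + z) ∈ A.ker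
  rw [h]
  simpa using hk

theorem finiteDimensional_ker_of_comp_sub_id {A : X →L[ℂ] Y} {L : Y →L[ℂ] X}
    (h : L ∘L A - ContinuousLinearMap.id ℂ X ∈ finiteRank X X) : FiniteDimensional ℂ A.ker := by
  rw [mem_finiteRank] at h
  refine Submodule.finiteDimensional_of_le
    (S₂ := (L ∘L A - ContinuousLinearMap.id ℂ X).range) fun x hx => ⟨-x, ?_⟩
  have hx' : A x = 0 := hx
  simp [hx']

theorem closedComplemented_range_of_comp_sub_id {A : X →L[ℂ] Y} {L : Y →L[ℂ] X}
    (h : L ∘L A - ContinuousLinearMap.id ℂ X ∈ finiteRank X X) :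
    A.range.ClosedComplemented := by
  rw [mem_finiteRank] at h
  set F := L ∘L A - ContinuousLinearMap.id ℂ X with hF
  have hFx : ∀ x, F x = L (A x) - x := fun x => rfl
  let W : Submodule ℂ Y := F.range.map (A : X →ₗ[ℂ] Y)
  have hWR : W ≤ A.range := by
    rintro _ ⟨x, -, rfl⟩
    exact ⟨x, rfl⟩
  obtain ⟨P, hP⟩ := Submodule.ClosedComplemented.of_finiteDimensional W
  have hPR : ∀ y, (P y : Y) ∈ A.range := fun y => hWR (P y).2
  -- `A L` fixes the range of `A` up to an error in the finite dimensional `W`, which the projection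
  -- `P` restores.
  let Q : Y →L[ℂ] Y := A ∘L L + W.subtypeL ∘L P ∘L (ContinuousLinearMap.id ℂ Y - A ∘L L)
  have hQ : ∀ y, Q y ∈ A.range := fun y =>
    Submodule.add_mem _ ⟨L y, rfl⟩ (hPR _)
  refine ⟨Q.codRestrict A.range hQ, ?_⟩
  rintro ⟨_, x, rfl⟩
  refine Subtype.ext ?_
  have hmem : A x - A (L (A x)) ∈ W := by
    refine ⟨-F x, neg_mem ⟨x, rfl⟩, ?_⟩
    simp [hFx]
  have := congrArg Subtype.val (hP ⟨_, hmem⟩)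
  change A (L (A x)) + (P (A x - A (L (A x))) : Y) = A x
  rw [this]
  simp

end Split

/-! ### The projection property for tuples -/

section Projection

variable {X : Type*} [NormedAddCommGroup X] [NormedSpace ℂ X] {n : ℕ}

/-- The right ideal of bounded operators generated by a tuple and the finite rank operators. -/
def rightIdeal (T : Fin n → X →L[ℂ] X) : Submodule ℂ (X →L[ℂ] X) :=
  LinearMap.range (∑ i, LinearMap.mulLeft ℂ (T i) ∘ₗ LinearMap.proj (φ := fun _ => X →L[ℂ] X) i) ⊔
    finiteRank X X

/-- The left ideal of bounded operators generated by a tuple and the finite rank operators. -/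
def leftIdeal (T : Fin n → X →L[ℂ] X) : Submodule ℂ (X →L[ℂ] X) :=
  LinearMap.range (∑ i, LinearMap.mulRight ℂ (T i) ∘ₗ LinearMap.proj (φ := fun _ => X →L[ℂ] X) i) ⊔
    finiteRank X X

theorem mem_rightIdeal {T : Fin n → X →L[ℂ] X} {A : X →L[ℂ] X} :
    A ∈ rightIdeal T ↔ ∃ B : Fin n → X →L[ℂ] X, ∑ i, T i * B i - A ∈ finiteRank X X := by
  rw [rightIdeal, Submodule.mem_sup]
  constructor
  · rintro ⟨_, ⟨B, rfl⟩, F, hF, rfl⟩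
    exact ⟨B, by simpa using neg_mem hF⟩
  · rintro ⟨B, hB⟩
    exact ⟨_, ⟨B, rfl⟩, _, neg_mem hB, by simp⟩

theorem mem_leftIdeal {T : Fin n → X →L[ℂ] X} {A : X →L[ℂ] X} :
    A ∈ leftIdeal T ↔ ∃ B : Fin n → X →L[ℂ] X, ∑ i, B i * T i - A ∈ finiteRank X X := by
  rw [leftIdeal, Submodule.mem_sup]
  constructor
  · rintro ⟨_, ⟨B, rfl⟩, F, hF, rfl⟩
    exact ⟨B, by simpa using neg_mem hF⟩
  · rintro ⟨B, hB⟩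
    exact ⟨_, ⟨B, rfl⟩, _, neg_mem hB, by simp⟩

theorem one_mem_rightIdeal_iff {T : Fin n → X →L[ℂ] X} :
    1 ∈ rightIdeal T ↔
      ∃ S : X →L[ℂ] (Fin n → X), rowOp T ∘L S - ContinuousLinearMap.id ℂ X ∈ finiteRank X X := by
  rw [mem_rightIdeal]
  constructor
  · rintro ⟨B, hB⟩
    refine ⟨ContinuousLinearMap.pi B, ?_⟩
    convert hB using 2
    on_goal 2 => rfl
    ext x
    simp [rowOp_apply]
  · rintro ⟨S, hS⟩
    refine ⟨fun i => (ContinuousLinearMap.proj i).comp S, ?_⟩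
    convert hS using 2
    on_goal 2 => rfl
    ext x
    simp [rowOp_apply]

theorem one_mem_leftIdeal_iff {T : Fin n → X →L[ℂ] X} :
    1 ∈ leftIdeal T ↔
      ∃ L : (Fin n → X) →L[ℂ] X, L ∘L colOp T - ContinuousLinearMap.id ℂ X ∈ finiteRank X X := by
  rw [mem_leftIdeal]
  constructor
  · rintro ⟨B, hB⟩
    refine ⟨rowOp B, ?_⟩
    convert hB using 2
    on_goal 2 => rfl
    ext x
    simp [rowOp_apply, colOp_apply]
  · rintro ⟨L, hL⟩
    refine ⟨fun i => L.comp (ContinuousLinearMap.single ℂ (fun _ => X) i), ?_⟩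
    convert hL using 2
    on_goal 2 => rfl
    ext x
    have : colOp T x = ∑ i, Pi.single i (T i x) :=
      (Finset.univ_sum_single (colOp T x)).symm
    simp [this]

theorem mul_mem_rightIdeal {T : Fin n → X →L[ℂ] X} {A : X →L[ℂ] X} (hA : A ∈ rightIdeal T)
    (C : X →L[ℂ] X) : A * C ∈ rightIdeal T := by
  rw [mem_rightIdeal] at *
  obtain ⟨B, hB⟩ := hA
  refine ⟨fun i => B i * C, ?_⟩
  have := mul_mem_finiteRank_right hB C
  simpa only [sub_mul, Finset.sum_mul, mul_assoc] using this

theorem mul_mem_leftIdeal {T : Fin n → X →L[ℂ] X} {A : X →L[ℂ] X} (hA : A ∈ leftIdeal T)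
    (C : X →L[ℂ] X) : C * A ∈ leftIdeal T := by
  rw [mem_leftIdeal] at *
  obtain ⟨B, hB⟩ := hA
  refine ⟨fun i => C * B i, ?_⟩
  have := mul_mem_finiteRank_left hB C
  simpa only [mul_sub, Finset.mul_sum, mul_assoc] using this

theorem commute_mul_mem_rightIdeal {T : Fin n → X →L[ℂ] X} {A S : X →L[ℂ] X}
    (hS : ∀ i, Commute (T i) S) (hA : A ∈ rightIdeal T) : S * A ∈ rightIdeal T := by
  rw [mem_rightIdeal] at *
  obtain ⟨B, hB⟩ := hA
  refine ⟨fun i => S * B i, ?_⟩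
  have := mul_mem_finiteRank_left hB S
  simpa only [mul_sub, Finset.mul_sum, ← mul_assoc, (hS _).eq] using this

theorem commute_mul_mem_leftIdeal {T : Fin n → X →L[ℂ] X} {A S : X →L[ℂ] X}
    (hS : ∀ i, Commute (T i) S) (hA : A ∈ leftIdeal T) : A * S ∈ leftIdeal T := by
  rw [mem_leftIdeal] at *
  obtain ⟨B, hB⟩ := hA
  refine ⟨fun i => B i * S, ?_⟩
  have := mul_mem_finiteRank_right hB S
  simpa only [sub_mul, Finset.sum_mul, mul_assoc, (hS _).eq] using this

/-- The last coefficient of a representation of `1` for `(T, S - μ)` inverts `S - μ` on the right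
modulo the ideal of `T`. -/
theorem one_mem_rightIdeal_of_forall_snoc [CompleteSpace X]
    {T : Fin n → X →L[ℂ] X} {S : X →L[ℂ] X}
    (hS : ∀ i, Commute (T i) S)
    (h : ∀ μ : ℂ, 1 ∈ rightIdeal
      (Fin.snoc (α := fun _ => X →L[ℂ] X) T (S - μ • ContinuousLinearMap.id ℂ X))) :
    1 ∈ rightIdeal T := by
  refine one_mem_of_right_ideal _ (fun _ ha b => mul_mem_rightIdeal ha b) S
    (fun _ ha => commute_mul_mem_rightIdeal hS ha) fun μ => ?_
  obtain ⟨B, hB⟩ := mem_rightIdeal.1 (h μ)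
  refine ⟨B (Fin.last n), mem_rightIdeal.2 ⟨fun i => -B i.castSucc, ?_⟩⟩
  simp only [Fin.sum_univ_castSucc, Fin.snoc_castSucc, Fin.snoc_last] at hB
  have := neg_mem hB
  simp only [mul_neg, Finset.sum_neg_distrib]
  rw [Algebra.algebraMap_eq_smul_one]
  convert this using 1
  change _ - ((S - μ • ContinuousLinearMap.id ℂ X) * _ - 1) = _
  abel

theorem one_mem_leftIdeal_of_forall_snoc [CompleteSpace X]
    {T : Fin n → X →L[ℂ] X} {S : X →L[ℂ] X}
    (hS : ∀ i, Commute (T i) S)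
    (h : ∀ μ : ℂ, 1 ∈ leftIdeal
      (Fin.snoc (α := fun _ => X →L[ℂ] X) T (S - μ • ContinuousLinearMap.id ℂ X))) :
    1 ∈ leftIdeal T := by
  refine one_mem_of_left_ideal _ (fun _ ha b => mul_mem_leftIdeal ha b) S
    (fun _ ha => commute_mul_mem_leftIdeal hS ha) fun μ => ?_
  obtain ⟨B, hB⟩ := mem_leftIdeal.1 (h μ)
  refine ⟨B (Fin.last n), mem_leftIdeal.2 ⟨fun i => -B i.castSucc, ?_⟩⟩
  simp only [Fin.sum_univ_castSucc, Fin.snoc_castSucc, Fin.snoc_last] at hB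
  have := neg_mem hB
  simp only [neg_mul, Finset.sum_neg_distrib]
  rw [Algebra.algebraMap_eq_smul_one]
  convert this using 1
  change _ - (_ * (S - μ • ContinuousLinearMap.id ℂ X) - 1) = _
  abel

theorem one_mem_rightIdeal_snoc {T : Fin n → X →L[ℂ] X} (S : X →L[ℂ] X)
    (h : 1 ∈ rightIdeal T) :
    1 ∈ rightIdeal (Fin.snoc (α := fun _ => X →L[ℂ] X) T S) := by
  obtain ⟨B, hB⟩ := mem_rightIdeal.1 h
  refine mem_rightIdeal.2 ⟨Fin.snoc (α := fun _ => X →L[ℂ] X) B 0, ?_⟩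
  simpa [Fin.sum_univ_castSucc] using hB

theorem one_mem_leftIdeal_snoc {T : Fin n → X →L[ℂ] X} (S : X →L[ℂ] X)
    (h : 1 ∈ leftIdeal T) :
    1 ∈ leftIdeal (Fin.snoc (α := fun _ => X →L[ℂ] X) T S) := by
  obtain ⟨B, hB⟩ := mem_leftIdeal.1 h
  refine mem_leftIdeal.2 ⟨Fin.snoc (α := fun _ => X →L[ℂ] X) B 0, ?_⟩
  simpa [Fin.sum_univ_castSucc] using hB

theorem rangeInf_le_range_rowOp (T : Fin n → X →L[ℂ] X) : rangeInf T ≤ (rowOp T).range := by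
  refine (iInf_le _ 0).trans (iSup_le fun i => ?_)
  rintro _ ⟨x, rfl⟩
  refine ⟨Pi.single i x, ?_⟩
  change rowOp T (Pi.single i x) = (T i ^ (0 + 1)) x
  rw [rowOp_apply, Finset.sum_eq_single i (fun j _ hj => by simp [Pi.single_eq_of_ne hj])
    (fun hi => absurd (Finset.mem_univ i) hi)]
  simp

/-- Finite codimension of `R^∞` passes to the larger range of the row operator, which is what
constructing a right inverse requires. -/
theorem isLowerSplitSemiBrowder_iff [CompleteSpace X]
    {T : Fin n → X →L[ℂ] X} :
    IsLowerSplitSemiBrowder T ↔ FiniteDimensional ℂ (X ⧸ rangeInf T) ∧ 1 ∈ rightIdeal T := by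
  rw [one_mem_rightIdeal_iff]
  refine and_congr_right fun hfin => ⟨fun h => ?_, fun ⟨S, hS⟩ => ?_⟩
  · exact exists_right_inverse_mod_finiteRank _
      (Submodule.CoFG.of_le (rangeInf_le_range_rowOp T) hfin) h
  · exact closedComplemented_ker_of_comp_sub_id hS

theorem isUpperSplitSemiBrowder_iff [CompleteSpace X]
    {T : Fin n → X →L[ℂ] X} :
    IsUpperSplitSemiBrowder T ↔ FiniteDimensional ℂ (kerInf T) ∧ 1 ∈ leftIdeal T := by
  rw [one_mem_leftIdeal_iff]
  constructor
  · rintro ⟨⟨⟨hK, -⟩, hfin⟩, hR⟩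
    exact ⟨hfin, exists_left_inverse_mod_finiteRank _ hK hR⟩
  · rintro ⟨hfin, L, hL⟩
    have hR := closedComplemented_range_of_comp_sub_id hL
    exact ⟨⟨⟨finiteDimensional_ker_of_comp_sub_id hL, hR.isClosed⟩, hfin⟩, hR⟩

/-! ### Finiteness of `N^∞` and, by duality, of the codimension of `R^∞` -/

theorem coe_pow_apply (A : X →L[ℂ] X) (k : ℕ) (x : X) :
    ((A : Module.End ℂ X) ^ k) x = (A ^ k) x := by
  induction k with
  | zero => rfl
  | succ k ih => rw [pow_succ', pow_succ', Module.End.mul_apply, ih]; rfl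

theorem commute_toLinearMap {A B : X →L[ℂ] X} (h : Commute A B) :
    Commute (A : Module.End ℂ X) (B : Module.End ℂ X) :=
  LinearMap.ext fun x => DFunLike.congr_fun h.eq x

theorem finiteDimensional_kerInf {T : Fin n → X →L[ℂ] X} (hT : ∀ i j, Commute (T i) (T j))
    {S : X →L[ℂ] X} (hS : ∀ i, Commute (T i) S) (h1 : FiniteDimensional ℂ (colOp T).ker)
    (h : ∀ μ : ℂ, FiniteDimensional ℂ (kerInf
      (Fin.snoc (α := fun _ => X →L[ℂ] X) T (S - μ • ContinuousLinearMap.id ℂ X)))) :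
    FiniteDimensional ℂ (kerInf T) := by
  obtain ⟨W', hW', hle⟩ := exists_finiteDimensional_of_forall_shift
    (fun i => (T i : Module.End ℂ X)) (fun i j => commute_toLinearMap (hT i j))
    (S : Module.End ℂ X) (fun i => commute_toLinearMap (hS i))
    (Submodule.finiteDimensional_of_le (S₂ := (colOp T).ker) fun x hx =>
      funext fun i => (mem_jointKer_one _ _).1 hx i) _ h fun μ x k hx hSx => by
      rw [mem_kerInf]
      -- The given `k` may be `0`, while `N^∞` asks for a positive exponent.
      refine ⟨k + 1, k.succ_pos, Fin.lastCases ?_ fun i => ?_⟩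
      · rw [Fin.snoc_last, pow_succ', mul_apply_eq_comp, ← coe_pow_apply]
        refine (congrArg _ ?_).trans (map_zero _)
        exact hSx
      · rw [Fin.snoc_castSucc, pow_succ', mul_apply_eq_comp, ← coe_pow_apply, hx i, map_zero]
  refine Submodule.finiteDimensional_of_le (S₂ := W') fun x hx => ?_
  obtain ⟨k, -, hk⟩ := (mem_kerInf T x).1 hx
  exact hle k x fun i => by rw [coe_pow_apply, hk i]

theorem dualMap_pow_apply (A : X →L[ℂ] X) (k : ℕ) (φ : Module.Dual ℂ X) (x : X) :
    (((LinearMap.dualMap (A : X →ₗ[ℂ] X) : Module.End ℂ (Module.Dual ℂ X)) ^ k) φ) x =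
      φ ((A ^ k) x) := by
  induction k generalizing x with
  | zero => rfl
  | succ k ih =>
    rw [pow_succ', Module.End.mul_apply, LinearMap.dualMap_apply, pow_succ, mul_apply_eq_comp]
    exact ih _

theorem commute_dualMap {A B : X →L[ℂ] X} (h : Commute A B) :
    Commute (LinearMap.dualMap (A : X →ₗ[ℂ] X) : Module.End ℂ (Module.Dual ℂ X))
      (LinearMap.dualMap (B : X →ₗ[ℂ] X)) :=
  LinearMap.ext fun φ => LinearMap.ext fun x => congrArg φ (DFunLike.congr_fun h.eq x).symm

theorem mem_dualAnnihilator_powRange {T : Fin n → X →L[ℂ] X} {k : ℕ} {φ : Module.Dual ℂ X} :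
    φ ∈ (powRange T k).dualAnnihilator ↔ ∀ i x, φ ((T i ^ k) x) = 0 := by
  rw [powRange, Submodule.dualAnnihilator_iSup_eq, Submodule.mem_iInf]
  refine forall_congr' fun i => ?_
  rw [Submodule.mem_dualAnnihilator]
  exact ⟨fun h x => h _ ⟨x, rfl⟩, by rintro h _ ⟨x, rfl⟩; exact h x⟩

/-- Annihilators turn sums of ranges into joint kernels of the transposes. In the algebraic dual
every subspace of `X` is recovered from its annihilator, so no closedness of ranges is needed. -/
theorem finiteDimensional_quotient_rangeInf {T : Fin n → X →L[ℂ] X}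
    (hT : ∀ i j, Commute (T i) (T j)) {S : X →L[ℂ] X} (hS : ∀ i, Commute (T i) S)
    (h1 : FiniteDimensional ℂ (X ⧸ (rowOp T).range))
    (h : ∀ μ : ℂ, FiniteDimensional ℂ (X ⧸ rangeInf
      (Fin.snoc (α := fun _ => X →L[ℂ] X) T (S - μ • ContinuousLinearMap.id ℂ X)))) :
    FiniteDimensional ℂ (X ⧸ rangeInf T) := by
  have hann : ∀ p : Submodule ℂ X, FiniteDimensional ℂ (X ⧸ p) →
      FiniteDimensional ℂ p.dualAnnihilator := fun p hp =>
    p.dualQuotEquivDualAnnihilator.finiteDimensional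
  have hfin := hann _ h1
  obtain ⟨W', hW', hle⟩ := exists_finiteDimensional_of_forall_shift
    (fun i => (LinearMap.dualMap (T i : X →ₗ[ℂ] X) : Module.End ℂ (Module.Dual ℂ X)))
    (fun i j => commute_dualMap (hT i j)) (LinearMap.dualMap (S : X →ₗ[ℂ] X))
    (fun i => commute_dualMap (hS i))
    (Submodule.finiteDimensional_of_le (S₂ := (rowOp T).range.dualAnnihilator) fun φ hφ => by
      rw [Submodule.mem_dualAnnihilator]
      rintro _ ⟨x, rfl⟩
      change φ (rowOp T x) = 0
      rw [rowOp_apply, map_sum]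
      exact Finset.sum_eq_zero fun i _ =>
        DFunLike.congr_fun ((mem_jointKer_one _ _).1 hφ i) (x i))
    _ (fun μ => hann _ (h μ)) fun μ φ k hφ hSφ => by
      refine Submodule.dualAnnihilator_anti (iInf_le _ k) (mem_dualAnnihilator_powRange.2 ?_)
      refine Fin.lastCases (fun x => ?_) fun i x => ?_
      · rw [Fin.snoc_last, pow_succ, mul_apply_eq_comp, ← dualMap_pow_apply]
        have : (LinearMap.dualMap ((S - μ • ContinuousLinearMap.id ℂ X : X →L[ℂ] X) : X →ₗ[ℂ] X) :
            Module.End ℂ (Module.Dual ℂ X)) =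
            LinearMap.dualMap (S : X →ₗ[ℂ] X) - algebraMap ℂ _ μ := by
          ext ψ y
          simp [Algebra.algebraMap_eq_smul_one]
        rw [this, hSφ, LinearMap.zero_apply]
      · rw [Fin.snoc_castSucc, pow_succ, mul_apply_eq_comp, ← dualMap_pow_apply, hφ i,
          LinearMap.zero_apply]
  -- `W'` contains the annihilator of every `powRange T (k + 1)`, so the vectors killed by `W'` lie
  -- in all of these.
  have hco : W'.dualCoannihilator ≤ rangeInf T := by
    refine le_iInf fun k x hx => ?_
    rw [← Subspace.forall_mem_dualAnnihilator_apply_eq_zero_iff]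
    intro φ hφ
    refine (Submodule.mem_dualCoannihilator _).1 hx φ (hle (k + 1) φ fun i => ?_)
    ext x
    rw [dualMap_pow_apply]
    exact mem_dualAnnihilator_powRange.1 hφ i x
  exact Submodule.CoFG.of_le hco (Subspace.finiteDimensional_quot_dualCoannihilator_iff.2 hW')

/-! ### Adjoining one operator, and passage to spectra -/

theorem rangeInf_le_rangeInf_snoc (T : Fin n → X →L[ℂ] X) (S : X →L[ℂ] X) :
    rangeInf T ≤ rangeInf (Fin.snoc (α := fun _ => X →L[ℂ] X) T S) := by
  refine iInf_mono fun k => iSup_le fun i => ?_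
  refine le_trans (le_of_eq ?_) (le_iSup _ i.castSucc)
  simp

theorem kerInf_snoc_le_kerInf (T : Fin n → X →L[ℂ] X) (S : X →L[ℂ] X) :
    kerInf (Fin.snoc (α := fun _ => X →L[ℂ] X) T S) ≤ kerInf T := by
  intro x hx
  rw [mem_kerInf] at *
  obtain ⟨k, hk, h⟩ := hx
  exact ⟨k, hk, fun i => by simpa using h i.castSucc⟩

theorem isLowerSplitSemiBrowder_iff_forall_snoc [CompleteSpace X]
    {T : Fin n → X →L[ℂ] X} (hT : ∀ i j, Commute (T i) (T j)) {S : X →L[ℂ] X}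
    (hS : ∀ i, Commute (T i) S) :
    IsLowerSplitSemiBrowder T ↔ ∀ μ : ℂ, IsLowerSplitSemiBrowder
      (Fin.snoc (α := fun _ => X →L[ℂ] X) T (S - μ • ContinuousLinearMap.id ℂ X)) := by
  simp only [isLowerSplitSemiBrowder_iff]
  refine ⟨fun h μ => ⟨Submodule.CoFG.of_le (rangeInf_le_rangeInf_snoc T _) h.1,
    one_mem_rightIdeal_snoc _ h.2⟩, fun h => ?_⟩
  have h1 := one_mem_rightIdeal_of_forall_snoc hS fun μ => (h μ).2
  obtain ⟨L, hL⟩ := one_mem_rightIdeal_iff.1 h1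
  exact ⟨finiteDimensional_quotient_rangeInf hT hS
    (finiteDimensional_quotient_range_of_comp_sub_id hL) fun μ => (h μ).1, h1⟩

theorem isUpperSplitSemiBrowder_iff_forall_snoc [CompleteSpace X]
    {T : Fin n → X →L[ℂ] X} (hT : ∀ i j, Commute (T i) (T j)) {S : X →L[ℂ] X}
    (hS : ∀ i, Commute (T i) S) :
    IsUpperSplitSemiBrowder T ↔ ∀ μ : ℂ, IsUpperSplitSemiBrowder
      (Fin.snoc (α := fun _ => X →L[ℂ] X) T (S - μ • ContinuousLinearMap.id ℂ X)) := by
  simp only [isUpperSplitSemiBrowder_iff]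
  refine ⟨fun h μ => ⟨?_, one_mem_leftIdeal_snoc _ h.2⟩, fun h => ?_⟩
  · have := h.1
    exact Submodule.finiteDimensional_of_le (kerInf_snoc_le_kerInf T _)
  have h1 := one_mem_leftIdeal_of_forall_snoc hS fun μ => (h μ).2
  obtain ⟨L, hL⟩ := one_mem_leftIdeal_iff.1 h1
  exact ⟨finiteDimensional_kerInf hT hS
    (finiteDimensional_ker_of_comp_sub_id hL) fun μ => (h μ).1, h1⟩

theorem commute_shift {A B : X →L[ℂ] X} (h : Commute A B) (a b : ℂ) :
    Commute (A - a • ContinuousLinearMap.id ℂ X) (B - b • ContinuousLinearMap.id ℂ X) := by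
  have hid : ∀ (c : ℂ) (C : X →L[ℂ] X), Commute C (c • ContinuousLinearMap.id ℂ X) := fun c C =>
    (Commute.one_right C).smul_right c
  exact (h.sub_right (hid b A)).sub_left (hid a _).symm

theorem shift_eq_snoc (T : Fin (n + 1) → X →L[ℂ] X) (lam : Fin (n + 1) → ℂ) :
    shift T lam = Fin.snoc (α := fun _ => X →L[ℂ] X)
      (shift (fun i : Fin n => T i.castSucc) fun i => lam i.castSucc)
      (T (Fin.last n) - lam (Fin.last n) • ContinuousLinearMap.id ℂ X) := by
  funext i
  refine Fin.lastCases ?_ (fun j => ?_) i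
  · rw [Fin.snoc_last]; rfl
  · rw [Fin.snoc_castSucc]; rfl

/-- A set of points `lam` whose complement is described by a property of tuples satisfying the
projection property projects onto the corresponding set. -/
theorem image_setOf_not_shift_eq (P : ∀ {m : ℕ}, (Fin m → X →L[ℂ] X) → Prop)
    (T : Fin (n + 1) → X →L[ℂ] X)
    (hP : ∀ lam : Fin n → ℂ, P (shift (fun i : Fin n => T i.castSucc) lam) ↔
      ∀ μ : ℂ, P (Fin.snoc (α := fun _ => X →L[ℂ] X) (shift (fun i : Fin n => T i.castSucc) lam)
        (T (Fin.last n) - μ • ContinuousLinearMap.id ℂ X))) :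
    (fun (lam : Fin (n + 1) → ℂ) (i : Fin n) => lam i.castSucc) '' {lam | ¬ P (shift T lam)} =
      {lam | ¬ P (shift (fun i : Fin n => T i.castSucc) lam)} := by
  ext lam
  rw [Set.mem_ofPred_eq, hP, not_forall]
  constructor
  · rintro ⟨lam, h, rfl⟩
    rw [Set.mem_ofPred_eq, shift_eq_snoc] at h
    exact ⟨_, h⟩
  · rintro ⟨μ, h⟩
    refine ⟨Fin.snoc (α := fun _ => ℂ) lam μ, ?_, by simp⟩
    rw [Set.mem_ofPred_eq, shift_eq_snoc]
    simpa using h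

end Projection

end SemiBrowder

theorem proposition3p2 {X : Type*} [NormedAddCommGroup X] [NormedSpace ℂ X] [CompleteSpace X]
    (n : ℕ) (T : Fin (n + 1) → X →L[ℂ] X) (hT : ∀ i j, Commute (T i) (T j)) :
    (fun (lam : Fin (n + 1) → ℂ) (i : Fin n) => lam i.castSucc) ''
        SemiBrowder.lowerSplitSpectrum T =
      SemiBrowder.lowerSplitSpectrum (fun i : Fin n => T i.castSucc) ∧
    (fun (lam : Fin (n + 1) → ℂ) (i : Fin n) => lam i.castSucc) ''
        SemiBrowder.upperSplitSpectrum T =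
      SemiBrowder.upperSplitSpectrum (fun i : Fin n => T i.castSucc) := by
  have hlast : ∀ (lam : Fin n → ℂ) (i : Fin n),
      Commute (SemiBrowder.shift (fun i : Fin n => T i.castSucc) lam i) (T (Fin.last n)) :=
    fun lam i => by
      simpa [SemiBrowder.shift] using SemiBrowder.commute_shift (hT i.castSucc (Fin.last n)) (lam i) 0
  have hcomm : ∀ (lam : Fin n → ℂ) (i j : Fin n),
      Commute (SemiBrowder.shift (fun i : Fin n => T i.castSucc) lam i)
        (SemiBrowder.shift (fun i : Fin n => T i.castSucc) lam j) :=
    fun lam i j => SemiBrowder.commute_shift (hT _ _) _ _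
  exact ⟨SemiBrowder.image_setOf_not_shift_eq SemiBrowder.IsLowerSplitSemiBrowder T fun lam =>
      SemiBrowder.isLowerSplitSemiBrowder_iff_forall_snoc (hcomm lam) (hlast lam),
    SemiBrowder.image_setOf_not_shift_eq SemiBrowder.IsUpperSplitSemiBrowder T fun lam =>
      SemiBrowder.isUpperSplitSemiBrowder_iff_forall_snoc (hcomm lam) (hlast lam)⟩
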